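/- Let $\mathbb{T}=\mathbb{R}/\mathbb{Z}$ carry Lebesgue measure, and for $n\ge 1$ and $f:\mathbb{T}\to\mathbb{R}$ let $$R_nf(x)=\frac1n\sum_{k=0}^{n-1}f\Big(x+\frac kn\Big),\qquad x\in\mathbb{T}.$$ Let $p_1<p_2<\cdots$ be the sequence of all primes and let $$E=\Big\{\prod_{1\le i\le k,\ i\ne j}p_i:\ k=2,3,\ldots,\ 1\le j\le k\Big\}.$$ Let $n_1<n_2<\cdots$ be the sequence of all elements of $E$ in increasing order, and let $\varphi:[0,\infty)\to[0,\infty)$ be a (not necessarily strictly) increasing function with $$\lim_{x\to\infty}\frac{\varphi(x)\ln\ln x}{x\ln x}=0.$$ Then there is a measurable function $f:\mathbb{T}\to\mathbb{R}$ with $\varphi(|f|)\in L^1(\mathbb{T})$ (that is, $f\in L^\varphi(\mathbb{T})$) such that for every $x\in\mathbb{T}$ the sequence $\big(R_{n_k}f(x)\big)_{k\ge1}$ is divergent, i.e. has no finite limit. -/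

import Mathlib

open MeasureTheory Filter Topology
open scoped NNReal

/-- The `n`-th Riemann sum `R_n f (x) = (1 / n) * ∑_{k = 0}^{n - 1} f (x + k / n)` of a function `f`
on the torus `𝕋 = ℝ / ℤ`. -/
noncomputable def riemannSum (n : ℕ) (f : UnitAddCircle → ℝ) (x : UnitAddCircle) : ℝ :=
  (1 / (n : ℝ)) * ∑ k ∈ Finset.range n, f (x + (((k : ℝ) / (n : ℝ) : ℝ) : UnitAddCircle))

/-- The set `E` of all products of the first `k ≥ 2` primes with exactly one of these `k` primes
left out. Here `Nat.nth Nat.Prime i` is the prime usually written `p_{i + 1}`. -/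
def primorialOmitOne : Set ℕ :=
  {n | ∃ k j : ℕ, 2 ≤ k ∧ j < k ∧ n = ∏ i ∈ (Finset.range k).erase j, Nat.nth Nat.Prime i}

/-- The class `L^φ(𝕋)`: (Lebesgue) measurable functions `f` on `𝕋` with `φ(|f|) ∈ L¹(𝕋)`. -/
def MemOrliczClass (φ : ℝ≥0 → ℝ≥0) (f : UnitAddCircle → ℝ) : Prop :=
  AEStronglyMeasurable f volume ∧ Integrable (fun x => (φ ‖f x‖₊ : ℝ)) volume

/-!
The function is built from blocks. Fix `M`, let `P = M#` be the primorial, and cut the torus into `P`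
cells of length `1 / P`, indexed by `ℤ / P`. If `p ≤ M` is prime, then `n = P / p` belongs to `E`, and
the points `x + k / n` visit exactly the cells that differ from the cell of `x` by a multiple of `p`.
So if `f` has the value `c` on a set `T` of cells, then `R_n f (x) ≥ c / n = c p / P` as soon as some
`t ∈ T` differs from the cell of `x` by a multiple of `p` (`div_le_riemannSum_indicator`). With
`c = 8 H P / M` and `p ∈ (M / 8, M]` this is at least `H`.

By Chebyshev's bounds there are `≳ M / log M` primes in `(M / 8, M]`, so the residues divisible by one
of them have density `u ≳ 1 / log M` (`half_sum_inv_le_card_multiples`). Greedily chosen translates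
(`exists_translates_cover`) show that a set `T` of `≲ log M` cells suffices to have
`sup_{n ∈ E} R_n f ≥ H` outside a set of measure `ε`. The cost is `|T| φ(c) / P ≲ log M · φ(c) / P`.
As `log c` is of order `M`, the hypothesis on `φ` gives `φ(c) = o(P / log M)`, so that the
cost tends to zero (`exists_block`).

Blocks with `H = m + 1` and costs at most `2 ^ (-m)` are combined by a supremum, which is almost
everywhere a maximum of finitely many terms by the Borel–Cantelli lemma; at almost every point the
sequence `R_n f`, `n ∈ E`, is then unbounded. On the exceptional null set, taken to be invariant under rational translations,
`f` is replaced by a function whose Riemann sums tend to infinity at every point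
(`exists_riemannSum_unbounded`).
-/

/-! ### Covering a finite group by translates -/

theorem exists_card_filter_sub_notMem_le {G : Type*} [AddCommGroup G] [Fintype G] [DecidableEq G]
    (U F : Finset G) :
    ∃ t : G, ((F.filter fun x => t - x ∉ U).card : ℝ) ≤
      F.card * (1 - U.card / Fintype.card G) := by
  have hG : (0 : ℝ) < Fintype.card G := by exact_mod_cast Fintype.card_pos
  have hcard (x : G) : (Finset.univ.filter fun t => t - x ∉ U).card = Uᶜ.card :=
    Finset.card_equiv (Equiv.subRight x) (by simp)
  have hsum : ∑ t : G, ((F.filter fun x => t - x ∉ U).card : ℝ)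
      = ∑ _t : G, (F.card * (1 - U.card / Fintype.card G) : ℝ) := by
    have h := Finset.sum_card_bipartiteAbove_eq_sum_card_bipartiteBelow
      (s := (Finset.univ : Finset G)) (t := F) (fun t x => t - x ∉ U)
    simp only [Finset.bipartiteAbove, Finset.bipartiteBelow, hcard, Finset.sum_const,
      smul_eq_mul] at h
    rw [← Nat.cast_sum, h, Finset.sum_const, Finset.card_univ, nsmul_eq_mul, Nat.cast_mul,
      Finset.card_compl, Nat.cast_sub (Finset.card_le_univ U)]
    field_simp
  obtain ⟨t, -, ht⟩ := Finset.exists_le_of_sum_le Finset.univ_nonempty hsum.le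
  exact ⟨t, ht⟩

/-- Greedy choice of translates: each new translate of `U` removes at least the proportion
`|U| / |G|` of what is left, since a random one does so on average. -/
theorem exists_translates_cover {G : Type*} [AddCommGroup G] [Fintype G] [DecidableEq G]
    (U : Finset G) (r : ℕ) :
    ∃ T : Finset G, T.card ≤ r ∧
      ((Finset.univ.filter fun x : G => ∀ t ∈ T, t - x ∉ U).card : ℝ) ≤
        (1 - U.card / Fintype.card G) ^ r * Fintype.card G := by
  induction r with
  | zero => exact ⟨∅, by simp⟩
  | succ r ih =>
    obtain ⟨T, hT, hcov⟩ := ih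
    obtain ⟨t, ht⟩ := exists_card_filter_sub_notMem_le U
      (Finset.univ.filter fun x : G => ∀ t ∈ T, t - x ∉ U)
    have hU : (0 : ℝ) ≤ 1 - U.card / Fintype.card G := by
      rw [sub_nonneg]
      exact div_le_one_of_le₀ (by exact_mod_cast Finset.card_le_univ U) (by positivity)
    refine ⟨insert t T, (Finset.card_insert_le _ _).trans (by lia), ?_⟩
    calc _ = (((Finset.univ.filter fun x : G => ∀ t ∈ T, t - x ∉ U).filter
          fun x => t - x ∉ U).card : ℝ) := by
          congr 2
          ext x
          simp [and_comm]
      _ ≤ _ := ht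
      _ ≤ _ := mul_le_mul_of_nonneg_right hcov hU
      _ = _ := by ring

/-! ### Multiples of a set of primes -/

theorem card_filter_dvd_range {P d : ℕ} (hP : 0 < P) (hd : d ∣ P) :
    (((Finset.range P).filter fun a => d ∣ a).card : ℝ) = P / d := by
  obtain ⟨m, rfl⟩ := hd
  have hd0 : 0 < d := Nat.pos_of_mul_pos_right hP
  have : (Finset.range (d * m)).filter (fun a => d ∣ a) = (Finset.range m).image (d * ·) := by
    ext a
    simp only [Finset.mem_filter, Finset.mem_range, Finset.mem_image]
    constructor
    · rintro ⟨ha, b, rfl⟩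
      exact ⟨b, lt_of_mul_lt_mul_left ha (Nat.zero_le d), rfl⟩
    · rintro ⟨b, hb, rfl⟩
      exact ⟨Nat.mul_lt_mul_of_pos_left hb hd0, dvd_mul_right _ _⟩
  rw [this, Finset.card_image_of_injective _ (fun x y h => Nat.eq_of_mul_eq_mul_left hd0 h)]
  have : (d : ℝ) ≠ 0 := by positivity
  simp [this]

/-- If the reciprocals of some prime divisors of `P` have sum at most `1 / 2`, then the proportion
of residues divisible by one of these primes is at least half of that sum: for each `p`, at most
half of the multiples of `p` are also multiples of another prime of the set. -/
theorem half_sum_inv_le_card_multiples {P : ℕ} (hP : 0 < P) (I : Finset ℕ)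
    (hI : ∀ p ∈ I, p.Prime ∧ p ∣ P) (hS : ∑ p ∈ I, (1 / p : ℝ) ≤ 1 / 2) :
    (P / 2 : ℝ) * ∑ p ∈ I, (1 / p : ℝ) ≤
      (((Finset.range P).filter fun a => ∃ p ∈ I, p ∣ a).card : ℝ) := by
  set D : ℕ → Finset ℕ := fun d => (Finset.range P).filter fun a => d ∣ a
  set A : ℕ → Finset ℕ := fun p => D p \ (I.erase p).biUnion fun q => D (p * q)
  have hA : ∀ p ∈ I, (P / 2 : ℝ) * (1 / p) ≤ (A p).card := by
    intro p hp
    have h1 : ((D p).card : ℝ) = P / p := card_filter_dvd_range hP (hI p hp).2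
    have h2 : (((I.erase p).biUnion fun q => D (p * q)).card : ℝ) ≤
        P / p * ∑ q ∈ I, (1 / q : ℝ) := by
      calc _ ≤ ((∑ q ∈ I.erase p, (D (p * q)).card : ℕ) : ℝ) := by
            exact_mod_cast Finset.card_biUnion_le
        _ = ∑ q ∈ I.erase p, (P / p * (1 / q) : ℝ) := by
            rw [Nat.cast_sum]
            refine Finset.sum_congr rfl fun q hq => ?_
            obtain ⟨hqp, hqI⟩ := Finset.mem_erase.1 hq
            rw [card_filter_dvd_range hP (((Nat.coprime_primes (hI p hp).1 (hI q hqI).1).2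
              (Ne.symm hqp)).mul_dvd_of_dvd_of_dvd (hI p hp).2 (hI q hqI).2)]
            push_cast
            rw [div_mul_div_comm, mul_one]
        _ ≤ ∑ q ∈ I, (P / p * (1 / q) : ℝ) :=
            Finset.sum_le_sum_of_subset_of_nonneg (Finset.erase_subset _ _)
              fun _ _ _ => by positivity
        _ = _ := by rw [Finset.mul_sum]
    have h3 : ((D p).card : ℝ) ≤
        (A p).card + ((I.erase p).biUnion fun q => D (p * q)).card := by
      exact_mod_cast Finset.card_le_card_sdiff_add_card
    have h4 : (P / p : ℝ) * ∑ q ∈ I, (1 / q : ℝ) ≤ P / p * (1 / 2) := by gcongr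
    have h5 : (P / 2 : ℝ) * (1 / p) = P / p * (1 / 2) := by ring
    linarith
  have hdisj : (I : Set ℕ).PairwiseDisjoint A := by
    intro p hp q hq hpq
    refine Finset.disjoint_left.2 fun a hap haq => ?_
    obtain ⟨hap1, hap2⟩ := Finset.mem_sdiff.1 hap
    have haq1 := (Finset.mem_sdiff.1 haq).1
    refine hap2 (Finset.mem_biUnion.2 ⟨q, Finset.mem_erase.2 ⟨hpq.symm, hq⟩, ?_⟩)
    refine Finset.mem_filter.2 ⟨(Finset.mem_filter.1 hap1).1, ?_⟩
    exact ((Nat.coprime_primes (hI p hp).1 (hI q hq).1).2 hpq).mul_dvd_of_dvd_of_dvd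
      (Finset.mem_filter.1 hap1).2 (Finset.mem_filter.1 haq1).2
  calc (P / 2 : ℝ) * ∑ p ∈ I, (1 / p : ℝ) ≤ ∑ p ∈ I, ((A p).card : ℝ) := by
        rw [Finset.mul_sum]
        exact Finset.sum_le_sum hA
    _ = ((I.biUnion A).card : ℝ) := by
        rw [Finset.card_biUnion hdisj, Nat.cast_sum]
    _ ≤ _ := by
        refine Nat.cast_le.2 (Finset.card_le_card fun a ha => ?_)
        obtain ⟨p, hp, hap⟩ := Finset.mem_biUnion.1 ha
        have := Finset.mem_filter.1 (Finset.mem_sdiff.1 hap).1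
        exact Finset.mem_filter.2 ⟨this.1, p, hp, this.2⟩

theorem card_filter_val_zmod {P : ℕ} [NeZero P] (q : ℕ → Prop) [DecidablePred q] :
    (Finset.univ.filter fun a : ZMod P => q a.val).card = ((Finset.range P).filter q).card := by
  refine Finset.card_nbij' ZMod.val (fun a => (a : ZMod P)) ?_ ?_ ?_ ?_
  · intro a ha
    simpa [ZMod.val_lt] using ha
  · intro a ha
    have : a < P ∧ q a := by simpa using ha
    simpa [ZMod.val_cast_of_lt this.1] using this.2
  · intro a _
    simp
  · intro a ha
    have : a < P ∧ q a := by simpa using ha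
    exact ZMod.val_cast_of_lt this.1

/-! ### The grid of mesh `1 / P` on the torus -/

/-- The index, modulo `P`, of the cell `[a / P, (a + 1) / P)` of the torus that contains `x`. -/
noncomputable def gridCell (P : ℕ) (x : UnitAddCircle) : ZMod P :=
  (⌊(P : ℝ) * (AddCircle.equivIco 1 0 x : ℝ)⌋ : ℤ)

theorem gridCell_coe (P : ℕ) (t : ℝ) : gridCell P (t : UnitAddCircle) = (⌊(P : ℝ) * t⌋ : ℤ) := by
  have h : ((AddCircle.equivIco 1 0 (t : UnitAddCircle) : ℝ)) = Int.fract t := by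
    exact (AddCircle.coe_equivIco_mk_apply (1 : ℝ) t).trans (by simp)
  have h2 : (P : ℝ) * t = P * Int.fract t + ((P * ⌊t⌋ : ℤ) : ℝ) := by
    push_cast
    rw [← mul_add, Int.fract_add_floor]
  rw [gridCell, h, h2, Int.floor_add_intCast]
  simp

theorem gridCell_add {P : ℕ} (hP : P ≠ 0) (x : UnitAddCircle) (m : ℕ) :
    gridCell P (x + ((m / P : ℝ) : UnitAddCircle)) = gridCell P x + m := by
  obtain ⟨t, rfl⟩ := QuotientAddGroup.mk_surjective x
  change gridCell P ((t : UnitAddCircle) + _) = gridCell P (t : UnitAddCircle) + m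
  have hP' : (P : ℝ) ≠ 0 := by exact_mod_cast hP
  rw [← AddCircle.coe_add, gridCell_coe, gridCell_coe, mul_add, mul_div_cancel₀ _ hP',
    Int.floor_add_natCast]
  simp

theorem measurable_gridCell (P : ℕ) : @Measurable _ _ _ ⊤ (gridCell P) := by
  have h : Measurable fun x : UnitAddCircle => (AddCircle.equivIco 1 0 x : ℝ) :=
    measurable_subtype_coe.comp (AddCircle.measurableEquivIco 1 0).measurable
  exact (measurable_from_top (f := fun z : ℤ => (z : ZMod P))).comp
    (Int.measurable_floor.comp (h.const_mul (P : ℝ)))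

theorem measurableSet_gridCell_preimage (P : ℕ) (S : Set (ZMod P)) :
    MeasurableSet (gridCell P ⁻¹' S) :=
  measurable_gridCell P trivial

/-- All cells have the same measure because they are translates of each other. -/
theorem volume_gridCell_preimage {P : ℕ} [NeZero P] (S : Finset (ZMod P)) :
    volume (gridCell P ⁻¹' (S : Set (ZMod P))) = S.card * (P : ENNReal)⁻¹ := by
  have hP : P ≠ 0 := NeZero.ne P
  have hadd (S : Finset (ZMod P)) : volume (gridCell P ⁻¹' (S : Set (ZMod P))) =
      ∑ a ∈ S, volume (gridCell P ⁻¹' {a}) := by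
    rw [← measure_biUnion_finset (μ := (volume : Measure UnitAddCircle)) (s := S)
      (f := fun a => gridCell P ⁻¹' {a})]
    · congr 1
      ext x
      simp
    · intro a _ b _ hab
      exact Disjoint.preimage _ (Set.disjoint_singleton.2 hab)
    · exact fun a _ => measurableSet_gridCell_preimage P _
  have hcell (a : ZMod P) : volume (gridCell P ⁻¹' {a}) = volume (gridCell P ⁻¹' {0}) := by
    rw [← measure_preimage_add_right (volume : Measure UnitAddCircle)
      ((a.val / P : ℝ) : UnitAddCircle) (gridCell P ⁻¹' {a})]
    congr 1
    ext x
    rw [Set.mem_preimage, Set.mem_preimage, gridCell_add hP, ZMod.natCast_zmod_val]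
    simp
  have huniv : (P : ENNReal) * volume (gridCell P ⁻¹' {0}) = 1 := by
    have h := hadd Finset.univ
    simp only [hcell, Finset.sum_const, Finset.card_univ, ZMod.card, Finset.coe_univ,
      Set.preimage_univ, UnitAddCircle.measure_univ, nsmul_eq_mul] at h
    exact h.symm
  rw [hadd]
  simp only [hcell, Finset.sum_const, nsmul_eq_mul]
  rw [ENNReal.eq_inv_of_mul_eq_one_left (mul_comm _ _ |>.trans huniv)]

/-! ### Riemann sums -/

theorem riemannSum_mono_on {n : ℕ} {f g : UnitAddCircle → ℝ} {x : UnitAddCircle}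
    (h : ∀ k : ℕ, f (x + ((k / n : ℝ) : UnitAddCircle)) ≤ g (x + ((k / n : ℝ) : UnitAddCircle))) :
    riemannSum n f x ≤ riemannSum n g x :=
  mul_le_mul_of_nonneg_left (Finset.sum_le_sum fun k _ => h k) (by positivity)

theorem div_le_riemannSum {n : ℕ} {f : UnitAddCircle → ℝ} (hf : 0 ≤ f) (x : UnitAddCircle)
    {k : ℕ} (hk : k < n) : f (x + ((k / n : ℝ) : UnitAddCircle)) / n ≤ riemannSum n f x := by
  rw [riemannSum, div_eq_inv_mul, one_div]
  exact mul_le_mul_of_nonneg_left (Finset.single_le_sum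
    (f := fun k : ℕ => f (x + ((k / n : ℝ) : UnitAddCircle))) (fun _ _ => hf _)
    (Finset.mem_range.2 hk)) (by positivity)

/-- If the cell `t` differs from the cell of `x` by a multiple of `p`, it contains one of the
points `x + k / n` with `n = P / p`. -/
theorem div_le_riemannSum_indicator {n p : ℕ} (hnp : n * p ≠ 0) {T : Set (ZMod (n * p))}
    {t : ZMod (n * p)} (ht : t ∈ T) {x : UnitAddCircle} (c : ℝ) (hc : 0 ≤ c)
    (hp : p ∣ (t - gridCell (n * p) x).val) :
    c / n ≤ riemannSum n ((gridCell (n * p) ⁻¹' T).indicator fun _ => c) x := by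
  have : NeZero (n * p) := ⟨hnp⟩
  have hn : (n : ℝ) ≠ 0 := by exact_mod_cast left_ne_zero_of_mul hnp
  have hp0 : (p : ℝ) ≠ 0 := by exact_mod_cast right_ne_zero_of_mul hnp
  obtain ⟨k, hk⟩ := hp
  have hkn : k < n := by
    have := ZMod.val_lt (t - gridCell (n * p) x)
    rw [hk, mul_comm n p] at this
    exact lt_of_mul_lt_mul_left this (Nat.zero_le p)
  have hcell : gridCell (n * p) (x + ((k / n : ℝ) : UnitAddCircle)) = t := by
    have h1 : (k / n : ℝ) = ((p * k : ℕ) : ℝ) / ((n * p : ℕ) : ℝ) := by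
      push_cast
      field_simp
    rw [h1, gridCell_add hnp, ← hk, ZMod.natCast_zmod_val]
    abel
  have h := div_le_riemannSum (f := (gridCell (n * p) ⁻¹' T).indicator fun _ => c)
    (fun y => Set.indicator_nonneg (fun _ _ => hc) y) x hkn
  rwa [Set.indicator_of_mem (by rwa [Set.mem_preimage, hcell])] at h

/-- Choose a base point in each coset of the torsion subgroup, and let `g x` be the square of the
order of `x` relative to its base point. If `x` has relative order `d`, then `x + 1 / n` has relative
order at least `n / d`, and this point alone contributes at least `n / d ^ 2` to `R_n g (x)`. -/
theorem exists_riemannSum_unbounded : ∃ g : UnitAddCircle → ℝ,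
    ∀ x (C : ℝ), ∃ N : ℕ, ∀ n ≥ N, C < riemannSum n g x := by
  let rep : UnitAddCircle → UnitAddCircle := fun x =>
    (QuotientAddGroup.mk x : UnitAddCircle ⧸ AddCommGroup.torsion UnitAddCircle).out
  have hrep (x : UnitAddCircle) : IsOfFinAddOrder (x - rep x) := by
    have h : (QuotientAddGroup.mk (rep x) : UnitAddCircle ⧸ AddCommGroup.torsion UnitAddCircle)
      = QuotientAddGroup.mk x := Quotient.out_eq _
    have h2 := QuotientAddGroup.eq.1 h
    rw [neg_add_eq_sub] at h2
    exact h2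
  refine ⟨fun x => (addOrderOf (x - rep x) : ℝ) ^ 2, fun x C => ?_⟩
  set d := addOrderOf (x - rep x) with hd
  have hd0 : 0 < d := (hrep x).addOrderOf_pos
  obtain ⟨N, hN⟩ := exists_nat_gt (C * (d : ℝ) ^ 2)
  refine ⟨max N 2, fun n hn => ?_⟩
  have hn2 : 2 ≤ n := (le_max_right _ _).trans hn
  have hn0 : (0 : ℝ) < n := by positivity
  have hNn : (N : ℝ) ≤ n := by exact_mod_cast (le_max_left _ _).trans hn
  set u : UnitAddCircle := (((1 : ℕ) / n : ℝ) : UnitAddCircle) with hu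
  have hou : addOrderOf u = n := by
    rw [hu, Nat.cast_one]
    exact AddCircle.addOrderOf_period_div (by omega)
  have hru : rep (x + u) = rep x := by
    have : (QuotientAddGroup.mk (x + u) : UnitAddCircle ⧸ AddCommGroup.torsion UnitAddCircle)
        = QuotientAddGroup.mk x := by
      symm
      refine QuotientAddGroup.eq.2 ?_
      rw [neg_add_cancel_left]
      exact addOrderOf_pos_iff.1 (by omega)
    simp only [rep, this]
  set d' := addOrderOf (x + u - rep (x + u)) with hd'
  have hd'0 : 0 < d' := (hrep _).addOrderOf_pos
  have hnd : n ≤ d * d' := by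
    refine Nat.le_of_dvd (by positivity) ?_
    rw [← hou, addOrderOf_dvd_iff_nsmul_eq_zero]
    have h1 : u = (x + u - rep (x + u)) - (x - rep x) := by
      rw [hru]
      abel
    rw [h1, nsmul_sub]
    rw [mul_nsmul' (x + u - rep (x + u)) d d', addOrderOf_nsmul_eq_zero, nsmul_zero,
      mul_comm d d', mul_nsmul' (x - rep x) d' d, addOrderOf_nsmul_eq_zero, nsmul_zero, sub_zero]
  have hnd' : (n : ℝ) ≤ d * d' := by exact_mod_cast hnd
  have h := div_le_riemannSum (n := n) (f := fun x => (addOrderOf (x - rep x) : ℝ) ^ 2)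
    (fun _ => by positivity) x (k := 1) (by omega)
  refine lt_of_lt_of_le ?_ h
  change C < (d' : ℝ) ^ 2 / n
  rw [lt_div_iff₀ hn0]
  have hd0' : (0 : ℝ) < d ^ 2 := by positivity
  refine lt_of_mul_lt_mul_right (a := (d : ℝ) ^ 2) ?_ hd0'.le
  calc C * (n : ℝ) * (d : ℝ) ^ 2 = (C * (d : ℝ) ^ 2) * n := by ring
    _ < (n : ℝ) * n := mul_lt_mul_of_pos_right (by linarith) hn0
    _ ≤ ((d : ℝ) * d') * (d * d') := by gcongr
    _ = (d' : ℝ) ^ 2 * (d : ℝ) ^ 2 := by ring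

/-! ### Primes in `(M / 8, M]` and primorials -/

theorem eventually_log_le_mul_sqrt {δ : ℝ} (hδ : 0 < δ) :
    ∀ᶠ M : ℕ in atTop, Real.log M ≤ δ * √(M : ℝ) := by
  have h := (isLittleO_log_rpow_atTop (r := 1 / 2) (by norm_num)).bound hδ
  filter_upwards [tendsto_natCast_atTop_atTop.eventually h] with M hM
  rw [Real.norm_eq_abs, Real.norm_eq_abs, ← Real.sqrt_eq_rpow,
    abs_of_nonneg (Real.sqrt_nonneg _)] at hM
  exact (le_abs_self _).trans hM

theorem eventually_log_le_mul {δ : ℝ} (hδ : 0 < δ) :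
    ∀ᶠ M : ℕ in atTop, Real.log M ≤ δ * M := by
  filter_upwards [eventually_log_le_mul_sqrt hδ, eventually_ge_atTop 1] with M hM h1
  refine hM.trans (mul_le_mul_of_nonneg_left ?_ hδ.le)
  have h1' : (1 : ℝ) ≤ M := by exact_mod_cast h1
  exact Real.sqrt_le_iff.2 ⟨by linarith, by nlinarith⟩

theorem eventually_half_le_theta : ∀ᶠ M : ℕ in atTop, (M / 2 : ℝ) ≤ Chebyshev.theta M := by
  filter_upwards [eventually_log_le_mul_sqrt (δ := 1 / 100) (by norm_num),
    eventually_log_le_mul (δ := 1 / 100) (by norm_num), eventually_ge_atTop 2] with M h1 h2 hM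
  have hM' : (2 : ℝ) ≤ M := by exact_mod_cast hM
  have h3 := Chebyshev.theta_ge M
  have h4 : Real.log (M + 1) ≤ 2 * Real.log M := by
    rw [← Real.log_rpow (by linarith)]
    refine Real.log_le_log (by linarith) ?_
    norm_num
    nlinarith
  have h5 : √(M : ℝ) * Real.log M ≤ 1 / 100 * M := by
    calc √(M : ℝ) * Real.log M ≤ √(M : ℝ) * (1 / 100 * √(M : ℝ)) := by gcongr
      _ = 1 / 100 * (√(M : ℝ) * √(M : ℝ)) := by ring
      _ = 1 / 100 * M := by rw [Real.mul_self_sqrt (by linarith)]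
  nlinarith [Real.log_two_gt_d9]

theorem log_four_lt : Real.log 4 < 1.4 := by
  have : (4 : ℝ) = 2 ^ (2 : ℕ) := by norm_num
  rw [this, Real.log_pow]
  have := Real.log_two_lt_d9
  push_cast
  linarith

/-- Chebyshev's bounds give at least `M / (4 log M)` primes in `(M / 8, M]`. -/
theorem eventually_exists_primes : ∀ᶠ M : ℕ in atTop, ∃ J : Finset ℕ,
    (∀ p ∈ J, p.Prime ∧ p ≤ M ∧ M < 8 * p) ∧ (M / 4 : ℝ) ≤ J.card * Real.log M := by
  filter_upwards [eventually_half_le_theta, eventually_ge_atTop 2] with M h1 hM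
  have hsub : Nat.primesLE (M / 8) ⊆ Nat.primesLE M := by
    intro p hp
    rw [Nat.mem_primesLE] at hp ⊢
    exact ⟨hp.1.trans (Nat.div_le_self _ _), hp.2⟩
  have hmem : ∀ p ∈ Nat.primesLE M \ Nat.primesLE (M / 8), p.Prime ∧ p ≤ M ∧ M < 8 * p := by
    intro p hp
    rw [Finset.mem_sdiff, Nat.mem_primesLE, Nat.mem_primesLE] at hp
    have : ¬ p ≤ M / 8 := fun h => hp.2 ⟨h, hp.1.2⟩
    exact ⟨hp.1.2, hp.1.1, by omega⟩
  refine ⟨Nat.primesLE M \ Nat.primesLE (M / 8), hmem, ?_⟩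
  have h2 := Chebyshev.theta_le_log4_mul_x (x := ((M / 8 : ℕ) : ℝ)) (by positivity)
  have h3 : ((M / 8 : ℕ) : ℝ) ≤ M / 8 := Nat.cast_div_le
  have h4 : Real.log 4 * ((M / 8 : ℕ) : ℝ) ≤ 1.4 * (M / 8) :=
    mul_le_mul log_four_lt.le h3 (by positivity) (by norm_num)
  have h5 := Finset.sum_sdiff (f := fun p : ℕ => Real.log p) hsub
  rw [← Chebyshev.theta_eq_sum_primesLE_log, ← Chebyshev.theta_eq_sum_primesLE_log] at h5
  have h6 : ∑ p ∈ Nat.primesLE M \ Nat.primesLE (M / 8), Real.log (p : ℝ) ≤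
      (Nat.primesLE M \ Nat.primesLE (M / 8)).card * Real.log M := by
    rw [← nsmul_eq_mul]
    refine Finset.sum_le_card_nsmul _ _ _ fun p hp => ?_
    refine Real.log_le_log (by exact_mod_cast (hmem p hp).1.pos) ?_
    exact_mod_cast (hmem p hp).2.1
  have hM0 : (0 : ℝ) ≤ M := by positivity
  linarith

theorem eventually_exists_primes_sum_inv : ∀ᶠ M : ℕ in atTop, ∃ I : Finset ℕ,
    (∀ p ∈ I, p.Prime ∧ p ≤ M ∧ M < 8 * p) ∧ 1 / (32 * Real.log M) ≤ ∑ p ∈ I, (1 / p : ℝ) ∧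
      ∑ p ∈ I, (1 / p : ℝ) ≤ 1 / 2 := by
  filter_upwards [eventually_exists_primes, eventually_log_le_mul (δ := 1 / 32) (by norm_num),
    eventually_ge_atTop 3] with M ⟨J, hJ, hcard⟩ hlog hM
  have hM' : (0 : ℝ) < M := by positivity
  have hlog1 : 1 ≤ Real.log M := by
    rw [Real.le_log_iff_exp_le hM']
    have : (3 : ℝ) ≤ M := by exact_mod_cast hM
    linarith [Real.exp_one_lt_d9]
  have hlog0 : 0 < Real.log M := by linarith
  -- Taking only some of the primes keeps the sum of the reciprocals below `1 / 2`.
  set s := ⌊(M : ℝ) / (16 * Real.log M)⌋₊ with hs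
  have hs1 : (s : ℝ) ≤ M / (16 * Real.log M) := Nat.floor_le (by positivity)
  have hs2 : M / (16 * Real.log M) < s + 1 := Nat.lt_floor_add_one _
  have hsJ : s ≤ J.card := by
    have : (s : ℝ) ≤ J.card := by
      refine hs1.trans ?_
      rw [div_le_iff₀ (by positivity)]
      linarith
    exact_mod_cast this
  obtain ⟨I, hIJ, hI⟩ := Finset.exists_subset_card_eq hsJ
  have hmem : ∀ p ∈ I, p.Prime ∧ p ≤ M ∧ M < 8 * p := fun p hp => hJ p (hIJ hp)
  refine ⟨I, hmem, ?_, ?_⟩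
  · have h1 : (I.card : ℝ) * (1 / M) ≤ ∑ p ∈ I, (1 / p : ℝ) := by
      rw [← nsmul_eq_mul]
      refine Finset.card_nsmul_le_sum _ _ _ fun p hp => ?_
      have hp0 : (0 : ℝ) < p := by exact_mod_cast (hmem p hp).1.pos
      exact one_div_le_one_div_of_le hp0 (by exact_mod_cast (hmem p hp).2.1)
    have h2 : 1 ≤ M / (32 * Real.log M) := by
      rw [le_div_iff₀ (by positivity)]
      linarith
    have h3 : M / (16 * Real.log M) = 2 * (M / (32 * Real.log M)) := by
      field_simp
      norm_num
    have h4 : M / (32 * Real.log M) ≤ s := by linarith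
    refine le_trans ?_ h1
    rw [hI]
    calc 1 / (32 * Real.log M) = M / (32 * Real.log M) * (1 / M) := by field_simp
      _ ≤ _ := by gcongr
  · have h1 : ∑ p ∈ I, (1 / p : ℝ) ≤ I.card * (8 / M) := by
      rw [← nsmul_eq_mul]
      refine Finset.sum_le_card_nsmul _ _ _ fun p hp => ?_
      have hp0 : (0 : ℝ) < p := by exact_mod_cast (hmem p hp).1.pos
      have hp8 : (M : ℝ) < 8 * p := by exact_mod_cast (hmem p hp).2.2
      rw [div_le_div_iff₀ hp0 hM']
      linarith
    refine h1.trans ?_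
    rw [hI]
    calc (s : ℝ) * (8 / M) ≤ M / (16 * Real.log M) * (8 / M) := by gcongr
      _ = 1 / 2 * (1 / Real.log M) := by field_simp; norm_num
      _ ≤ 1 / 2 * 1 := by
        gcongr
        rw [div_le_one hlog0]
        exact hlog1
      _ = 1 / 2 := by norm_num

theorem primorial_eq_prod_nth (M : ℕ) :
    primorial M = ∏ i ∈ Finset.range (Nat.count Nat.Prime (M + 1)), Nat.nth Nat.Prime i := by
  rw [primorial_eq_prod_primesLE]
  symm
  refine Finset.prod_nbij (Nat.nth Nat.Prime) ?_ ?_ ?_ fun _ _ => rfl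
  · intro i hi
    rw [Nat.mem_primesLE]
    exact ⟨Nat.lt_succ_iff.1 (Nat.nth_lt_of_lt_count (Finset.mem_range.1 hi)),
      Nat.prime_nth_prime i⟩
  · exact (Nat.nth_injective Nat.infinite_setOfPred_prime).injOn
  · intro p hp
    rw [Finset.mem_coe, Nat.mem_primesLE] at hp
    exact ⟨Nat.count Nat.Prime p, by
      simpa using Nat.count_strict_mono hp.2 (Nat.lt_succ_iff.2 hp.1), Nat.nth_count hp.2⟩

theorem exists_mul_eq_primorial {M p : ℕ} (hM : 3 ≤ M) (hp : p.Prime) (hpM : p ≤ M) :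
    ∃ n ∈ primorialOmitOne, n * p = primorial M := by
  have h2 : 2 ≤ Nat.count Nat.Prime (M + 1) :=
    le_trans (by decide) (Nat.count_monotone Nat.Prime (show 4 ≤ M + 1 by omega))
  have hlt : Nat.count Nat.Prime p < Nat.count Nat.Prime (M + 1) :=
    Nat.count_strict_mono hp (Nat.lt_succ_iff.2 hpM)
  refine ⟨_, ⟨_, Nat.count Nat.Prime p, h2, hlt, rfl⟩, ?_⟩
  rw [primorial_eq_prod_nth, ← Finset.prod_erase_mul _ _ (Finset.mem_range.2 hlt),
    Nat.nth_count hp]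

/-! ### The cost of one block -/

/-- The value `A · M# / M` taken by a block. -/
noncomputable def blockHeight (A : ℝ≥0) (M : ℕ) : ℝ≥0 := A * primorial M / M

theorem eventually_log_blockHeight {A : ℝ≥0} (hA : 0 < A) : ∀ᶠ M : ℕ in atTop,
    (M / 4 : ℝ) ≤ Real.log (blockHeight A M) ∧ Real.log (blockHeight A M) ≤ 2 * M := by
  have hconst : ∀ᶠ M : ℕ in atTop, |Real.log A| / (1 / 8) ≤ M :=
    tendsto_natCast_atTop_atTop.eventually_ge_atTop _
  filter_upwards [eventually_half_le_theta, eventually_log_le_mul (δ := 1 / 8) (by norm_num),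
    hconst, eventually_ge_atTop 1] with M h1 h2 h3 hM
  have hM0 : (1 : ℝ) ≤ M := by exact_mod_cast hM
  have hP : (0 : ℝ) < primorial M := by exact_mod_cast primorial_pos M
  have hA' : (0 : ℝ) < A := by exact_mod_cast hA
  have hlog : Real.log (blockHeight A M) = Real.log A + Chebyshev.theta M - Real.log M := by
    rw [Chebyshev.theta_eq_log_primorial, Nat.floor_natCast, blockHeight]
    push_cast
    rw [Real.log_div (by positivity) (by positivity), Real.log_mul hA'.ne' hP.ne']
  have h4 := Chebyshev.theta_le_log4_mul_x (x := (M : ℝ)) (by positivity)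
  have h5 : Real.log 4 * M ≤ 1.4 * M := by
    gcongr
    exact log_four_lt.le
  have h6 : 0 ≤ Real.log M := Real.log_nonneg hM0
  rw [div_le_iff₀ (by norm_num)] at h3
  rw [hlog]
  have h7 := neg_abs_le (Real.log A)
  have h8 := le_abs_self (Real.log A)
  constructor <;> linarith

theorem tendsto_blockHeight {A : ℝ≥0} (hA : 0 < A) : Tendsto (blockHeight A) atTop atTop := by
  rw [← NNReal.tendsto_coe_atTop]
  refine tendsto_atTop_mono' _ ?_ (tendsto_natCast_atTop_atTop.atTop_div_const
    (show (0 : ℝ) < 4 by norm_num))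
  filter_upwards [eventually_log_blockHeight hA] with M hM
  exact hM.1.trans (Real.log_le_self (NNReal.coe_nonneg _))

/-- The growth condition on `φ` enters here only: since `log (A · M# / M)` is of order `M`, it gives
`φ (A · M# / M) = o (M# / log M)`. -/
theorem eventually_mul_apply_blockHeight_le {φ : ℝ≥0 → ℝ≥0}
    (hlim : Tendsto (fun x : ℝ≥0 =>
      (φ x : ℝ) * Real.log (Real.log (x : ℝ)) / ((x : ℝ) * Real.log (x : ℝ))) atTop (𝓝 0))
    {A : ℝ≥0} (hA : 0 < A) {η : ℝ} (hη : 0 < η) : ∀ᶠ M : ℕ in atTop,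
    Real.log M * φ (blockHeight A M) ≤ η * primorial M := by
  have hA' : (0 : ℝ) < A := by exact_mod_cast hA
  have hη' : 0 < η / (4 * A) := by positivity
  have h := (tendsto_blockHeight hA).eventually (hlim.eventually (gt_mem_nhds hη'))
  filter_upwards [h, eventually_log_blockHeight hA, eventually_ge_atTop 16] with M h1 ⟨h2, h3⟩ hM
  have hM' : (16 : ℝ) ≤ M := by exact_mod_cast hM
  have hM0 : (0 : ℝ) < M := by linarith
  have hP : (0 : ℝ) < primorial M := by exact_mod_cast primorial_pos M
  have hc : (blockHeight A M : ℝ) = A * primorial M / M := by simp [blockHeight]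
  have hc0 : 0 < (blockHeight A M : ℝ) := by rw [hc]; positivity
  have hlogM : 0 < Real.log M := Real.log_pos (by linarith)
  have hlogc : 0 < Real.log (blockHeight A M) := by linarith
  have hloglog : Real.log M / 2 ≤ Real.log (Real.log (blockHeight A M)) := by
    refine le_trans ?_ (Real.log_le_log (by positivity) h2)
    rw [← Real.log_sqrt hM0.le]
    refine Real.log_le_log (by positivity) ?_
    rw [Real.sqrt_le_left (by positivity)]
    nlinarith
  rw [div_lt_iff₀ (by positivity)] at h1
  calc Real.log M * φ (blockHeight A M)
      = 2 * (φ (blockHeight A M) * (Real.log M / 2)) := by ring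
    _ ≤ 2 * (φ (blockHeight A M) * Real.log (Real.log (blockHeight A M))) := by gcongr
    _ ≤ 2 * (η / (4 * A) * (blockHeight A M * Real.log (blockHeight A M))) := by gcongr
    _ ≤ 2 * (η / (4 * A) * (blockHeight A M * (2 * M))) := by gcongr
    _ = η * primorial M := by
      rw [hc]
      field_simp
      norm_num

/-- The set on which some `R_n f`, `n ∈ E`, is at least `H` can be made almost everything by an `f`
that takes a single non-zero value `c` on a set `B`, at an arbitrarily small cost `|B| φ(c)`. -/
theorem exists_block {φ : ℝ≥0 → ℝ≥0}
    (hlim : Tendsto (fun x : ℝ≥0 =>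
      (φ x : ℝ) * Real.log (Real.log (x : ℝ)) / ((x : ℝ) * Real.log (x : ℝ))) atTop (𝓝 0))
    {H : ℝ≥0} (hH : 0 < H) {ε : ℝ≥0} (hε : 0 < ε) :
    ∃ (c : ℝ≥0) (B : Set UnitAddCircle), MeasurableSet B ∧ volume B ≤ ε ∧
      φ c * volume B ≤ ε ∧ volume {x | ∀ n ∈ primorialOmitOne,
        riemannSum n (B.indicator fun _ => (c : ℝ)) x < H} ≤ ε := by
  have hε' : (0 : ℝ) < ε := by exact_mod_cast hε
  set L : ℝ := max 1 (-Real.log ε) with hL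
  have hL1 : 1 ≤ L := le_max_left _ _
  have hLε : Real.exp (-L) ≤ ε := by
    rw [← Real.le_log_iff_exp_le hε']
    linarith [le_max_right 1 (-Real.log (ε : ℝ))]
  obtain ⟨M, ⟨I, hI, hI1, hI2⟩, hφM, hlogM, hM⟩ :=
    (eventually_exists_primes_sum_inv.and ((eventually_mul_apply_blockHeight_le hlim
      (A := 8 * H) (by positivity) (η := ε / (65 * L)) (by positivity)).and
      ((eventually_log_le_mul (δ := ε / (65 * L)) (by positivity)).and
        (eventually_ge_atTop 3)))).exists
  have hM' : (3 : ℝ) ≤ M := by exact_mod_cast hM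
  have hM0 : (0 : ℝ) < M := by linarith
  have hlog1 : 1 ≤ Real.log M := by
    rw [Real.le_log_iff_exp_le hM0]
    linarith [Real.exp_one_lt_d9]
  set P := primorial M with hP
  have hP0 : P ≠ 0 := primorial_ne_zero M
  have hPR : (0 : ℝ) < P := by exact_mod_cast primorial_pos M
  have : NeZero P := ⟨hP0⟩
  have hPE : (P : ENNReal) = ((P : ℝ≥0) : ENNReal) := by simp
  have hvol (S : Finset (ZMod P)) {a b : ℝ≥0} (h : (a : ℝ) * S.card ≤ b * P) :
      a * volume (gridCell P ⁻¹' (S : Set (ZMod P))) ≤ b := by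
    have h' : a * S.card ≤ b * P := by exact_mod_cast h
    rw [volume_gridCell_preimage, ← mul_assoc, ← div_eq_mul_inv]
    refine ENNReal.div_le_of_le_mul ?_
    rw [hPE]
    exact_mod_cast h'
  set c := blockHeight (8 * H) M with hc
  have hcR : (c : ℝ) = 8 * H * P / M := by simp [hc, blockHeight, hP]
  -- `U` consists of the cells divisible by some prime of `I`.
  set U : Finset (ZMod P) := Finset.univ.filter fun a => ∃ p ∈ I, p ∣ a.val with hU
  have hUcard : 1 / (64 * Real.log M) ≤ (U.card : ℝ) / Fintype.card (ZMod P) := by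
    have h := half_sum_inv_le_card_multiples (primorial_pos M) I
      (fun p hp => ⟨(hI p hp).1, (hI p hp).1.dvd_primorial_iff.2 (hI p hp).2.1⟩) hI2
    rw [hU, card_filter_val_zmod (fun a => ∃ p ∈ I, p ∣ a), ZMod.card, le_div_iff₀ hPR]
    refine le_trans ?_ h
    calc 1 / (64 * Real.log M) * (P : ℝ) = P / 2 * (1 / (32 * Real.log M)) := by
          field_simp
          norm_num
      _ ≤ _ := by gcongr
  set r := ⌈64 * L * Real.log M⌉₊ with hr
  have hr1 : 64 * L * Real.log M ≤ r := Nat.le_ceil _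
  have hr2 : (r : ℝ) ≤ 65 * L * Real.log M := by
    have h1 := Nat.ceil_lt_add_one (show 0 ≤ 64 * L * Real.log M by positivity)
    nlinarith
  obtain ⟨T, hTr, hT⟩ := exists_translates_cover U r
  have hTr' : (T.card : ℝ) ≤ 65 * L * Real.log M := le_trans (by exact_mod_cast hTr) hr2
  refine ⟨c, gridCell P ⁻¹' T, measurableSet_gridCell_preimage P _, ?_, ?_, ?_⟩
  · have := hvol T (a := 1) (b := ε) ?_
    · simpa using this
    · rw [NNReal.coe_one, one_mul]
      have hMP : (M : ℝ) ≤ P := by exact_mod_cast le_primorial_self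
      calc (T.card : ℝ) ≤ 65 * L * (ε / (65 * L) * M) := hTr'.trans (by gcongr)
        _ = ε * M := by field_simp
        _ ≤ ε * P := by gcongr
  · refine hvol T ?_
    calc (φ c : ℝ) * T.card ≤ φ c * (65 * L * Real.log M) := by gcongr
      _ = 65 * L * (Real.log M * φ c) := by ring
      _ ≤ 65 * L * (ε / (65 * L) * P) := by gcongr
      _ = ε * P := by field_simp
  · set Z : Finset (ZMod P) := Finset.univ.filter fun x => ∀ t ∈ T, t - x ∉ U with hZ
    have hZvol : volume (gridCell P ⁻¹' (Z : Set (ZMod P))) ≤ ε := by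
      have := hvol Z (a := 1) (b := ε) ?_
      · simpa using this
      · rw [NNReal.coe_one, one_mul]
        have hu0 : 0 ≤ 1 - (U.card : ℝ) / Fintype.card (ZMod P) := by
          rw [sub_nonneg]
          exact div_le_one_of_le₀ (by exact_mod_cast Finset.card_le_univ U) (by positivity)
        calc (Z.card : ℝ) ≤ (1 - (U.card : ℝ) / Fintype.card (ZMod P)) ^ r * P := by
              simpa only [ZMod.card] using hT
          _ ≤ Real.exp (-(1 / (64 * Real.log M))) ^ r * P := by
              gcongr
              refine le_trans ?_ (Real.add_one_le_exp _)
              linarith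
          _ = Real.exp (-(r / (64 * Real.log M))) * P := by
              rw [← Real.exp_nat_mul]
              congr 2
              ring
          _ ≤ Real.exp (-L) * P := by
              gcongr
              rw [le_div_iff₀ (by positivity)]
              linarith
          _ ≤ ε * P := by gcongr
    refine (measure_mono fun x hx => ?_).trans hZvol
    refine Finset.mem_coe.2 (Finset.mem_filter.2 ⟨Finset.mem_univ _, fun t ht htU => ?_⟩)
    obtain ⟨p, hp, hpt⟩ := (Finset.mem_filter.1 htU).2
    obtain ⟨n, hn, hnp⟩ := exists_mul_eq_primorial hM (hI p hp).1 (hI p hp).2.1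
    refine (hx n hn).not_ge ?_
    have hp0 : (0 : ℝ) < p := by exact_mod_cast (hI p hp).1.pos
    have hnpR : (n : ℝ) * p = P := by exact_mod_cast hnp
    have hn0 : (0 : ℝ) < n := by
      by_contra! h
      nlinarith
    have hHc : (H : ℝ) ≤ c / n := by
      have h8 : (M : ℝ) ≤ 8 * p := by exact_mod_cast (hI p hp).2.2.le
      rw [hcR, ← hnpR, le_div_iff₀ hn0, le_div_iff₀ hM0]
      calc (H : ℝ) * n * M ≤ H * n * (8 * p) := by gcongr
        _ = _ := by ring
    refine hHc.trans ?_
    -- The grid is indexed by `ZMod P`, so `P` has to become a variable before it is replaced by `n * p`.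
    clear_value c U r L
    clear hI1 hI2 hφM
    rw [← hP] at hnp
    clear_value P
    subst hnp
    exact div_le_riemannSum_indicator hP0 (Finset.mem_coe.2 ht) c c.2 hpt

/-! ### Combining the blocks -/

theorem finite_range_indicator {B : ℕ → Set UnitAddCircle} {c : ℕ → ℝ≥0} {x : UnitAddCircle}
    (hx : ∀ᶠ m in atTop, x ∉ B m) :
    (Set.range fun m => (B m).indicator (fun _ => c m) x).Finite := by
  obtain ⟨N, hN⟩ := eventually_atTop.1 hx
  refine ((Finset.range N).image (fun m => (B m).indicator (fun _ => c m) x) ∪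
    {0}).finite_toSet.subset ?_
  rintro _ ⟨m, rfl⟩
  rcases lt_or_ge m N with h | h
  · simp only [Finset.coe_union, Finset.coe_image, Set.mem_union]
    exact Or.inl ⟨m, by simpa using h, rfl⟩
  · simp [hN m h]

theorem theorem3 (n : ℕ → ℕ) (hn : StrictMono n) (hE : Set.range n = primorialOmitOne)
    (φ : ℝ≥0 → ℝ≥0) (hφ : Monotone φ)
    (hlim : Tendsto (fun x : ℝ≥0 =>
      (φ x : ℝ) * Real.log (Real.log (x : ℝ)) / ((x : ℝ) * Real.log (x : ℝ))) atTop (𝓝 0)) :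
    ∃ f : UnitAddCircle → ℝ, MemOrliczClass φ f ∧
      ∀ x : UnitAddCircle, ¬ ∃ L : ℝ, Tendsto (fun k => riemannSum (n k) f x) atTop (𝓝 L) := by
  classical
  have hblock (m : ℕ) := exists_block hlim (H := m + 1) (by positivity)
    (ε := (1 / 2) ^ m) (by positivity)
  choose c B hBmeas hBvol hBcost hBbad using hblock
  have hsum : ∑' m : ℕ, (((1 / 2 : ℝ≥0) ^ m : ℝ≥0) : ENNReal) ≠ ⊤ :=
    ENNReal.tsum_coe_ne_top_iff_summable.2 (NNReal.summable_geometric (by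
      rw [← NNReal.coe_lt_coe]; norm_num))
  obtain ⟨g, hg⟩ := exists_riemannSum_unbounded
  let F : UnitAddCircle → ℝ≥0 := fun x => ⨆ m, (B m).indicator (fun _ => c m) x
  let Good : UnitAddCircle → Prop := fun x => (∀ᶠ m in atTop, x ∉ B m) ∧
    ∀ᶠ m : ℕ in atTop, ∃ k ∈ primorialOmitOne,
      (m : ℝ) + 1 ≤ riemannSum k ((B m).indicator fun _ => (c m : ℝ)) x
  have hGood : ∀ᵐ x, Good x := by
    have h1 := ae_eventually_notMem (ne_top_of_le_ne_top hsum (ENNReal.tsum_le_tsum hBvol))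
    have h2 := ae_eventually_notMem (ne_top_of_le_ne_top hsum (ENNReal.tsum_le_tsum hBbad))
    filter_upwards [h1, h2] with x hx1 hx2
    refine ⟨hx1, hx2.mono fun m hm => ?_⟩
    by_contra! h
    exact hm fun k hk => by simpa using h k hk
  -- Riemann sums at `x` only see rational translates of `x`.
  let Orb : UnitAddCircle → Prop := fun x => ∀ q : ℚ, Good (x + ((q : ℝ) : UnitAddCircle))
  have hOrb : ∀ᵐ x, Orb x := ae_all_iff.2 fun q =>
    (measurePreserving_add_right volume _).quasiMeasurePreserving.ae hGood
  have hOrb_add (x : UnitAddCircle) (q : ℚ) (hx : Orb x) :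
      Orb (x + ((q : ℝ) : UnitAddCircle)) := fun q' => by
    have := hx (q + q')
    rwa [Rat.cast_add, AddCircle.coe_add, ← add_assoc] at this
  have hOrb_good (x : UnitAddCircle) (hx : Orb x) : Good x := by simpa using hx 0
  have hfrac (k n : ℕ) : (k / n : ℝ) = ((k / n : ℚ) : ℝ) := by push_cast; rfl
  have hOrb_iff (x : UnitAddCircle) (k n : ℕ) :
      Orb (x + ((k / n : ℝ) : UnitAddCircle)) ↔ Orb x := by
    rw [hfrac]
    refine ⟨fun h => ?_, hOrb_add x _⟩
    have := hOrb_add _ (-(k / n : ℚ)) h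
    rwa [add_assoc, ← AddCircle.coe_add, ← Rat.cast_add, add_neg_cancel, Rat.cast_zero,
      AddCircle.coe_zero, add_zero] at this
  let f : UnitAddCircle → ℝ := fun x => if Orb x then (F x : ℝ) else g x
  have hfF : f =ᵐ[volume] fun x => (F x : ℝ) := by
    filter_upwards [hOrb] with x hx
    exact if_pos hx
  have hFmeas : Measurable F :=
    Measurable.iSup fun m => measurable_const.indicator (hBmeas m)
  have hφF : Integrable (fun x => (φ (F x) : ℝ)) volume := by
    refine ⟨(hφ.measurable.comp hFmeas).coe_nnreal_real.aestronglyMeasurable, ?_⟩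
    rw [hasFiniteIntegral_iff_enorm]
    have hle : ∀ᵐ x, ‖(φ (F x) : ℝ)‖ₑ ≤
        (φ 0 : ENNReal) + ∑' m, (B m).indicator (fun _ => (φ (c m) : ENNReal)) x := by
      filter_upwards [hGood] with x hx
      rw [Real.enorm_eq_ofReal (NNReal.coe_nonneg _), ENNReal.ofReal_coe_nnreal]
      -- The supremum is attained, so `F x` is `0` or some `c m` with `x ∈ B m`.
      obtain ⟨m, hm⟩ := (Set.range_nonempty _).csSup_mem (finite_range_indicator (c := c) hx.1)
      change _ = F x at hm
      rw [← hm]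
      by_cases hxm : x ∈ B m
      · refine le_add_left (le_trans ?_ (ENNReal.le_tsum m))
        simp [hxm]
      · simp [hxm]
    refine (lintegral_mono_ae hle).trans_lt ?_
    rw [lintegral_add_left measurable_const, lintegral_tsum fun m =>
      (measurable_const.indicator (hBmeas m)).aemeasurable, lintegral_const,
      UnitAddCircle.measure_univ, mul_one]
    refine ENNReal.add_lt_top.2 ⟨ENNReal.coe_lt_top, ?_⟩
    refine lt_of_le_of_lt (ENNReal.tsum_le_tsum fun m => ?_) hsum.lt_top
    rw [lintegral_indicator_const (hBmeas m)]
    exact hBcost m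
  refine ⟨f, ⟨⟨fun x => (F x : ℝ), hFmeas.coe_nnreal_real.stronglyMeasurable, hfF⟩, ?_⟩, ?_⟩
  · refine hφF.congr ?_
    filter_upwards [hfF] with x hx
    rw [hx]
    simp
  · rintro x ⟨L, hL⟩
    obtain ⟨C, hC⟩ := hL.bddAbove_range
    replace hC (k : ℕ) : riemannSum (n k) f x ≤ C := hC ⟨k, rfl⟩
    by_cases hx : Orb x
    · obtain ⟨m, ⟨k, hk, hkm⟩, hm⟩ := ((hOrb_good x hx).2.and
        (tendsto_natCast_atTop_atTop.eventually_ge_atTop C)).exists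
      rw [← hE] at hk
      obtain ⟨i, rfl⟩ := hk
      have h1 : riemannSum (n i) ((B m).indicator fun _ => (c m : ℝ)) x ≤
          riemannSum (n i) f x := by
        refine riemannSum_mono_on fun k => ?_
        have hk := (hOrb_iff x k (n i)).2 hx
        simp only [f, if_pos hk]
        have h2 := le_ciSup (f := fun m => (B m).indicator (fun _ => c m)
            (x + ((k / n i : ℝ) : UnitAddCircle)))
          (finite_range_indicator (hOrb_good _ hk).1).bddAbove m
        refine le_trans (le_of_eq ?_) (NNReal.coe_le_coe.2 h2)
        simp only [Set.indicator]
        split_ifs <;> simp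
      linarith [hC i]
    · obtain ⟨N, hN⟩ := hg x C
      have h1 := hN (n N) (hn.id_le N)
      have h2 : riemannSum (n N) g x ≤ riemannSum (n N) f x := by
        refine riemannSum_mono_on fun k => ?_
        have hk : ¬ Orb (x + ((k / n N : ℝ) : UnitAddCircle)) := by rwa [hOrb_iff]
        simp only [f, if_neg hk, le_refl]
      linarith [hC N]
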